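/- Let $G$ be a simple graph with totally ordered vertex set $I$, and let $\Psi\subseteq I$ be a set of vertices, called odd. Write $\alpha\,\zeta\,\beta$ if $\alpha=\beta$ or $\alpha,\beta$ are adjacent in $G$. A \emph{heap} is a finite set $E\subset I\times\{0,1,2,\dots\}$ of pieces $(\alpha,m)$ (position $\alpha$, level $m$) such that distinct pieces with $\zeta$-related positions have different levels, and for every $(\alpha,m)\in E$ with $m>0$ there is $(\beta,m-1)\in E$ with $\alpha\,\zeta\,\beta$. Heaps form a monoid $\mathcal H(I,\zeta)$ under superposition $E\circ F$ (the pieces of $F$, lower ones first, fall over $E$), whose unit is the empty heap. The \emph{standard word} $\operatorname{st}(E)$ is the lexicographically greatest word $p_1\cdots p_k\in I^*$ with $p_1\circ\cdots\circ p_k=E$, and $\mathcal H(I,\zeta)$ is totally ordered by $E\le F \iff \operatorname{st}(E)\le\operatorname{st}(F)$ lexicographically. A heap is \emph{odd} if it has an odd number of pieces with positions in $\Psi$. The order $\le_E$ on the pieces of $E$ is the reflexive and transitive closure of the relation that relates $(\alpha,m)$ to $(\beta,n)$ when $\alpha\,\zeta\,\beta$ and $m<n$. A heap $E$ is a \emph{Lyndon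 heap} if it is non-empty, primitive ($E=U\circ V=V\circ U$ implies that $U$ or $V$ is empty) and minimal in its conjugacy class, conjugacy being the transitive closure of the relation between $U\circ V$ and $V\circ U$. It is a \emph{super Lyndon heap} if it is a Lyndon heap, or $E=F\circ F$ for some odd Lyndon heap $F$. Let $i\in I$. A \emph{super-letter with basis $i$} is a heap $E$ that has exactly one $\le_E$-minimal piece, this piece being at position $i$, that has exactly one piece at position $i$, and all of whose positions are $\ge i$. Let $\mathcal A_i(I,\zeta)\subset\mathcal H(I,\zeta)$ be the set of these, with the induced total order, and let $\mathcal A_i^*(I,\zeta)$ be the submonoid of $\mathcal H(I,\zeta)$ that it generates. A non-empty word over $\mathcal A_i(I,\zeta)$ is a \emph{Lyndon word} if it is lexicographically strictly smaller than all its proper cyclic rotations; a word is a \emph{super Lyndon word} if it is a Lyndon word, or is of the form $uu$ with $u$ a Lyndon word whose product is an odd heap. Then every $E\in\mathcal A_i^*(I,\zeta)$ is the product of a unique word over $\mathcal A_i(I,\zeta)$ (that is, $\mathcal A_i^*(I,\zeta)$ is free on $\mathcal A_i(I,\zeta)$), and this word is a super Lyndon word if and only if $E$ is a super Lyndon heap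 in $\mathcal H(I,\zeta)$. -/

import Mathlib

noncomputable section

open scoped Classical

namespace HeapsOfPieces

variable {I : Type*} [LinearOrder I]

/-- The concurrency relation `ζ` of a graph: two positions are concurrent when they do not commute,
that is, when they are equal or adjacent. -/
def Conc (G : SimpleGraph I) (a b : I) : Prop := a = b ∨ G.Adj a b

lemma Conc.symm {G : SimpleGraph I} {a b : I} (h : Conc G a b) : Conc G b a :=
  h.elim (fun h => Or.inl h.symm) (fun h => Or.inr h.symm)

/-- A heap over `(I, ζ)`: a finite set of pieces `(position, level)` in which two distinct concurrent
pieces are at different levels (pre-heap) and in which every piece above the floor lies on a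
concurrent piece one level below. -/
@[ext]
structure Heap (G : SimpleGraph I) where
  pieces : Finset (I × ℕ)
  level_ne : ∀ p ∈ pieces, ∀ q ∈ pieces, p ≠ q → Conc G p.1 q.1 → p.2 ≠ q.2
  supported : ∀ p ∈ pieces, 0 < p.2 → ∃ q ∈ pieces, q.2 + 1 = p.2 ∧ Conc G p.1 q.1

namespace Heap

variable {G : SimpleGraph I}

/-- The level at which a piece dropped at position `a` over `E` comes to rest. -/
def restLevel (E : Heap G) (a : I) : ℕ :=
  (E.pieces.filter fun p => Conc G p.1 a).sup fun p => p.2 + 1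

lemma lt_restLevel {E : Heap G} {a : I} {p : I × ℕ} (hp : p ∈ E.pieces) (h : Conc G p.1 a) :
    p.2 < E.restLevel a :=
  Nat.lt_of_succ_le (Finset.le_sup (f := fun p : I × ℕ => p.2 + 1) (by simp [hp, h]))

lemma exists_restLevel {E : Heap G} {a : I} (h : 0 < E.restLevel a) :
    ∃ q ∈ E.pieces, q.2 + 1 = E.restLevel a ∧ Conc G q.1 a := by
  have hne : (E.pieces.filter fun p => Conc G p.1 a).Nonempty := by
    rw [Finset.nonempty_iff_ne_empty]
    intro h0
    simp [restLevel, h0] at h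
  obtain ⟨q, hq, hq'⟩ := Finset.exists_mem_eq_sup _ hne (fun p : I × ℕ => p.2 + 1)
  simp only [Finset.mem_filter] at hq
  exact ⟨q, hq.1, hq'.symm, hq.2⟩

lemma restLevel_eq {E : Heap G} {a : I} {n : ℕ}
    (h1 : ∀ q ∈ E.pieces, Conc G q.1 a → q.2 < n)
    (h2 : 0 < n → ∃ q ∈ E.pieces, q.2 + 1 = n ∧ Conc G q.1 a) : E.restLevel a = n := by
  apply le_antisymm
  · refine Finset.sup_le fun q hq => ?_
    simp only [Finset.mem_filter] at hq
    exact h1 q hq.1 hq.2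
  · rcases Nat.eq_zero_or_pos n with h | h
    · omega
    · obtain ⟨q, hq, hq', hc⟩ := h2 h
      have := lt_restLevel hq hc
      omega

/-- Drop one piece at position `a` over the heap `E`. -/
def push (E : Heap G) (a : I) : Heap G where
  pieces := insert (a, E.restLevel a) E.pieces
  level_ne := by
    intro p hp q hq hpq hc
    simp only [Finset.mem_insert] at hp hq
    rcases hp with rfl | hp <;> rcases hq with rfl | hq
    · exact absurd rfl hpq
    · exact (lt_restLevel hq hc.symm).ne'
    · exact (lt_restLevel hp hc).ne
    · exact E.level_ne p hp q hq hpq hc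
  supported := by
    intro p hp h0
    simp only [Finset.mem_insert] at hp
    rcases hp with rfl | hp
    · obtain ⟨q, hq, h1, h2⟩ := exists_restLevel h0
      exact ⟨q, by simp [hq], h1, h2.symm⟩
    · obtain ⟨q, hq, h1⟩ := E.supported p hp h0
      exact ⟨q, by simp [hq], h1⟩

/-- Drop pieces at the positions `w = a₁ a₂ ⋯ aₖ` over `E`, one after another. -/
def drop (E : Heap G) (w : List I) : Heap G := w.foldl push E

/-- The pieces of a heap as pairs (level, position), listed from the floor upwards. -/
def sortedPieces (E : Heap G) : List (ℕ ×ₗ I) :=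
  (E.pieces.image fun p => toLex (p.2, p.1)).sort

/-- The positions of the pieces of a heap, listed from the floor upwards. -/
def positions (E : Heap G) : List I := E.sortedPieces.map fun p => (ofLex p).2

/-- The empty heap. -/
instance : One (Heap G) := ⟨⟨∅, by simp, by simp⟩⟩

/-- The superposition `E ∘ F`: the pieces of `F` fall over `E`, the lower ones first. -/
instance : Mul (Heap G) := ⟨fun E F => E.drop F.positions⟩

lemma one_pieces : (1 : Heap G).pieces = ∅ := rfl

lemma mul_def (E F : Heap G) : E * F = E.drop F.positions := rfl

lemma not_mem_push (E : Heap G) (a : I) : (a, E.restLevel a) ∉ E.pieces := fun h =>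
  lt_irrefl _ (lt_restLevel (E := E) (a := a) h (Or.inl rfl))

lemma restLevel_push {E : Heap G} {a b : I} (h : ¬ Conc G a b) :
    (E.push a).restLevel b = E.restLevel b := by
  simp only [restLevel, push, Finset.filter_insert, h, if_false]

lemma push_comm (E : Heap G) {a b : I} (h : ¬ Conc G a b) :
    (E.push a).push b = (E.push b).push a := by
  have h' : ¬ Conc G b a := fun hc => h hc.symm
  ext1
  change insert (b, (E.push a).restLevel b) (insert (a, E.restLevel a) E.pieces) =
    insert (a, (E.push b).restLevel a) (insert (b, E.restLevel b) E.pieces)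
  rw [restLevel_push h, restLevel_push h', Finset.insert_comm]

lemma drop_push (E : Heap G) (a : I) (w : List I) (h : ∀ b ∈ w, ¬ Conc G b a) :
    (E.push a).drop w = (E.drop w).push a := by
  induction w generalizing E with
  | nil => rfl
  | cons b w ih =>
    change ((E.push a).push b).drop w = ((E.push b).drop w).push a
    rw [← push_comm E (h b (by simp)), ih _ (fun c hc => h c (by simp [hc]))]

lemma mem_sortedPieces {E : Heap G} {p : ℕ ×ₗ I} :
    p ∈ E.sortedPieces ↔ ((ofLex p).2, (ofLex p).1) ∈ E.pieces := by
  simp only [sortedPieces, Finset.mem_sort, Finset.mem_image, Prod.exists]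
  constructor
  · rintro ⟨a, n, h, rfl⟩
    exact h
  · intro h
    exact ⟨_, _, h, rfl⟩

lemma mul_push (E F : Heap G) (a : I) : E * F.push a = (E * F).push a := by
  have hmem : toLex (F.restLevel a, a) ∈ (F.push a).sortedPieces := by
    rw [mem_sortedPieces]
    simp [push]
  obtain ⟨s, t, hst⟩ := List.append_of_mem hmem
  have hsorted : (F.push a).sortedPieces.Pairwise (· ≤ ·) := Finset.pairwise_sort _ _
  have hnodup : (F.push a).sortedPieces.Nodup := Finset.sort_nodup _ _
  rw [hst] at hsorted hnodup
  have hF : F.sortedPieces = s ++ t := by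
    have hsub : (s ++ t).Sublist (s ++ toLex (F.restLevel a, a) :: t) := by simp
    refine List.Perm.eq_of_pairwise' (r := (· ≤ ·)) (Finset.pairwise_sort _ _)
      (hsorted.sublist hsub) ?_
    refine (List.perm_ext_iff_of_nodup (Finset.sort_nodup _ _) (hnodup.sublist hsub)).2 ?_
    intro p
    have h1 : p ∈ (F.push a).sortedPieces ↔ p = toLex (F.restLevel a, a) ∨ p ∈ s ++ t := by
      rw [hst]
      simp only [List.mem_append, List.mem_cons]
      tauto
    have h2 : p ∈ (F.push a).sortedPieces ↔
        p = toLex (F.restLevel a, a) ∨ p ∈ F.sortedPieces := by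
      rw [mem_sortedPieces, mem_sortedPieces]
      simp only [push, Finset.mem_insert]
      refine or_congr ⟨fun h => ?_, fun h => by rw [h]; rfl⟩ Iff.rfl
      rw [Prod.ext_iff] at h
      exact ofLex.injective (Prod.ext h.2 h.1)
    have h3 : toLex (F.restLevel a, a) ∉ F.sortedPieces := by
      rw [mem_sortedPieces]
      exact not_mem_push F a
    have h4 : toLex (F.restLevel a, a) ∉ s ++ t := by
      rw [List.nodup_middle, List.nodup_cons] at hnodup
      exact hnodup.1
    change p ∈ F.sortedPieces ↔ _
    by_cases hp : p = toLex (F.restLevel a, a)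
    · subst hp
      exact iff_of_false h3 h4
    · have := h1.symm.trans h2
      simpa [hp] using this.symm
  have ht : ∀ b ∈ t.map (fun p => (ofLex p).2), ¬ Conc G b a := by
    intro b hb hc
    obtain ⟨p, hp, rfl⟩ := List.mem_map.1 hb
    have hle : toLex (F.restLevel a, a) ≤ p := by
      rw [List.pairwise_append, List.pairwise_cons] at hsorted
      exact hsorted.2.1.1 p hp
    have hpF : p ∈ F.sortedPieces := by rw [hF]; simp [hp]
    rw [mem_sortedPieces] at hpF
    have := lt_restLevel hpF hc
    rw [Prod.Lex.le_iff] at hle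
    simp only [ofLex_toLex] at hle
    rcases hle with h | h
    · exact absurd this (not_lt.2 h.le)
    · exact absurd this (not_lt.2 h.1.le)
  have e1 : (F.push a).positions =
      s.map (fun p => (ofLex p).2) ++ a :: t.map (fun p => (ofLex p).2) := by
    simp [positions, hst]
  have e2 : F.positions = s.map (fun p => (ofLex p).2) ++ t.map (fun p => (ofLex p).2) := by
    simp [positions, hF]
  rw [mul_def, mul_def, e1, e2]
  simp only [drop, List.foldl_append, List.foldl_cons]
  exact drop_push _ a _ ht

lemma mul_drop (E F : Heap G) (w : List I) : E * F.drop w = (E * F).drop w := by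
  induction w generalizing F with
  | nil => rfl
  | cons a w ih =>
    change E * (F.push a).drop w = ((E * F).push a).drop w
    rw [ih, mul_push]

lemma exists_push {E : Heap G} (h : E.pieces.Nonempty) : ∃ (F : Heap G) (a : I), E = F.push a := by
  obtain ⟨p, hp, hmax⟩ := E.pieces.exists_max_image (fun p => p.2) h
  let F : Heap G :=
    { pieces := E.pieces.erase p
      level_ne := fun q hq r hr =>
        E.level_ne q (Finset.mem_of_mem_erase hq) r (Finset.mem_of_mem_erase hr)
      supported := by
        intro q hq h0
        obtain ⟨r, hr, h1, h2⟩ := E.supported q (Finset.mem_of_mem_erase hq) h0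
        refine ⟨r, Finset.mem_erase.2 ⟨?_, hr⟩, h1, h2⟩
        rintro rfl
        have := hmax q (Finset.mem_of_mem_erase hq)
        omega }
  have hlev : F.restLevel p.1 = p.2 := by
    apply restLevel_eq
    · intro q hq hc
      have hq' := Finset.mem_erase.1 hq
      exact lt_of_le_of_ne (hmax q hq'.2) (E.level_ne q hq'.2 p hp hq'.1 hc)
    · intro h0
      obtain ⟨r, hr, h1, h2⟩ := E.supported p hp h0
      refine ⟨r, Finset.mem_erase.2 ⟨?_, hr⟩, h1, h2.symm⟩
      rintro rfl
      omega
  refine ⟨F, p.1, ?_⟩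
  ext1
  change E.pieces = insert (p.1, F.restLevel p.1) (E.pieces.erase p)
  rw [hlev, Prod.mk.eta, Finset.insert_erase hp]

lemma push_card (E : Heap G) (a : I) : (E.push a).pieces.card = E.pieces.card + 1 :=
  Finset.card_insert_of_notMem (not_mem_push E a)

lemma exists_drop (E : Heap G) : ∃ w : List I, (1 : Heap G).drop w = E := by
  induction h : E.pieces.card generalizing E with
  | zero =>
    refine ⟨[], ?_⟩
    ext1
    exact (Finset.card_eq_zero.1 h).symm
  | succ n ih =>
    obtain ⟨F, a, rfl⟩ := exists_push (Finset.card_pos.1 (by omega : 0 < E.pieces.card))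
    rw [push_card] at h
    obtain ⟨w, hw⟩ := ih F (by omega)
    exact ⟨w ++ [a], by simp [drop, ← hw]⟩

lemma positions_one : (1 : Heap G).positions = [] := by
  simp [positions, sortedPieces, one_pieces]

/-- The heap monoid `H(I, ζ)`. -/
instance : Monoid (Heap G) where
  mul_assoc E F K := by rw [mul_def (E * F) K, ← mul_drop, ← mul_def]
  mul_one E := by rw [mul_def, positions_one]; rfl
  one_mul E := by
    obtain ⟨w, rfl⟩ := exists_drop E
    rw [mul_drop, mul_def, positions_one]
    rfl

/-- The heap with a single piece, at position `a`. -/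
def single (G : SimpleGraph I) (a : I) : Heap G where
  pieces := {(a, 0)}
  level_ne := by
    intro p hp q hq hpq
    simp only [Finset.mem_singleton] at hp hq
    exact absurd (hp.trans hq.symm) hpq
  supported := by
    intro p hp h0
    simp only [Finset.mem_singleton] at hp
    simp [hp] at h0

/-- The map `ψ : I^* → H(I, ζ)`, `p₁ ⋯ pₖ ↦ p₁ ∘ ⋯ ∘ pₖ`. -/
def ofWord (G : SimpleGraph I) (w : List I) : Heap G := (w.map (single G)).prod

lemma push_eq_mul (E : Heap G) (a : I) : E.push a = E * single G a := by
  simp [mul_def, positions, sortedPieces, single, drop]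

lemma drop_eq_mul (E : Heap G) (w : List I) : E.drop w = E * ofWord G w := by
  induction w generalizing E with
  | nil => simp [ofWord, drop]
  | cons a w ih =>
    change (E.push a).drop w = _
    rw [ih, push_eq_mul, mul_assoc]
    simp [ofWord]

lemma ofWord_surjective (E : Heap G) : ∃ w : List I, ofWord G w = E := by
  obtain ⟨w, hw⟩ := exists_drop E
  exact ⟨w, by rw [← hw, drop_eq_mul, one_mul]⟩

lemma drop_positions (E : Heap G) (w : List I) :
    (E.drop w).pieces.val.map Prod.fst = E.pieces.val.map Prod.fst + (w : Multiset I) := by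
  induction w generalizing E with
  | nil => simp [drop]
  | cons a w ih =>
    change ((E.push a).drop w).pieces.val.map Prod.fst = _
    rw [ih]
    change (insert (a, E.restLevel a) E.pieces).val.map Prod.fst + _ = _
    rw [Finset.insert_val_of_notMem (not_mem_push E a), Multiset.map_cons, ← Multiset.cons_coe,
      Multiset.cons_add, Multiset.add_cons]

lemma ofWord_finite (E : Heap G) : {w : List I | ofWord G w = E}.Finite := by
  obtain ⟨v, hv⟩ := ofWord_surjective E
  have key : ∀ w : List I, (ofWord G w).pieces.val.map Prod.fst = (w : Multiset I) := by
    intro w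
    rw [← one_mul (ofWord G w), ← drop_eq_mul, drop_positions, one_pieces]
    simp
  refine (List.finite_toSet v.permutations).subset fun w hw => ?_
  simp only [Set.mem_ofPred_eq, List.mem_permutations] at hw ⊢
  rw [← Multiset.coe_eq_coe, ← key, ← key, hw, hv]

lemma exists_standardWord (E : Heap G) : ∃ w, IsGreatest {w : List I | ofWord G w = E} w := by
  obtain ⟨w, hw, hmax⟩ :=
    Set.exists_max_image {w : List I | ofWord G w = E} id (ofWord_finite E) (ofWord_surjective E)
  exact ⟨w, hw, fun v hv => hmax v hv⟩

/-- The standard word `st(E)`: the lexicographically greatest word representing `E`. -/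
def standardWord (E : Heap G) : List I := (exists_standardWord E).choose

lemma standardWord_spec (E : Heap G) :
    IsGreatest {w : List I | ofWord G w = E} E.standardWord := (exists_standardWord E).choose_spec

lemma standardWord_injective : Function.Injective (standardWord (G := G)) := fun E F h => by
  rw [← (standardWord_spec E).1, ← (standardWord_spec F).1, h]

/-- The total order on heaps: `E ≤ F` iff `st(E) ≤ st(F)` lexicographically. -/
instance : LinearOrder (Heap G) := LinearOrder.lift' standardWord standardWord_injective

/-- The partial order `≤_E` on the pieces of `E`. -/
def PieceLE (E : Heap G) : I × ℕ → I × ℕ → Prop :=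
  Relation.ReflTransGen fun p q => p ∈ E.pieces ∧ q ∈ E.pieces ∧ Conc G p.1 q.1 ∧ p.2 < q.2

/-- The set `min E` of minimal pieces of `E` for `≤_E`. -/
def minPieces (E : Heap G) : Set (I × ℕ) :=
  {p | p ∈ E.pieces ∧ ∀ q ∈ E.pieces, E.PieceLE q p → q = p}

/-- `E` is a pyramid with basis `a`: it has a unique minimal piece, at position `a`. -/
def IsPyramid (E : Heap G) (a : I) : Prop := ∃ n, E.minPieces = {(a, n)}

/-- A pyramid with basis `a` is admissible if `a` is its lowest position. -/
def IsAdmissiblePyramid (E : Heap G) (a : I) : Prop :=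
  E.IsPyramid a ∧ ∀ p ∈ E.pieces, a ≤ p.1

/-- A pyramid with basis `a` is elementary if it has exactly one piece at position `a`. -/
def IsElementaryPyramid (E : Heap G) (a : I) : Prop :=
  E.IsPyramid a ∧ (E.pieces.filter fun p => p.1 = a).card = 1

/-- `E` is odd: it has an odd number of pieces whose positions are odd vertices. -/
def IsOdd (Ψ : Set I) (E : Heap G) : Prop := Odd (E.pieces.filter fun p => p.1 ∈ Ψ).card

/-- `E` is primitive: `E = U ∘ V = V ∘ U` only if `U` or `V` is empty. -/
def IsPrimitive (E : Heap G) : Prop := ∀ U V : Heap G, E = U * V → E = V * U → U = 1 ∨ V = 1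

/-- `F` is a transpose of `E`. -/
def IsTranspose (E F : Heap G) : Prop := ∃ U V : Heap G, E = U * V ∧ F = V * U

/-- Conjugacy of heaps: the transitive closure of transposition. -/
def IsConjugate : Heap G → Heap G → Prop := Relation.TransGen IsTranspose

/-- Lyndon heaps: non-empty, primitive, and minimal in their conjugacy class. -/
def IsLyndon (E : Heap G) : Prop := E ≠ 1 ∧ E.IsPrimitive ∧ ∀ F, IsConjugate E F → E ≤ F

/-- Super Lyndon heaps over the supergraph `(G, Ψ)`. -/
def IsSuperLyndon (Ψ : Set I) (E : Heap G) : Prop :=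
  E.IsLyndon ∨ ∃ F : Heap G, F.IsOdd Ψ ∧ F.IsLyndon ∧ E = F * F

end Heap

/-- The set `A_i(I, ζ)` of super-letters with basis `i`, ordered as a subset of `H(I, ζ)`. -/
def superLetters (G : SimpleGraph I) (i : I) : Set (Heap G) :=
  {E | E.IsAdmissiblePyramid i ∧ E.IsElementaryPyramid i}

/-- The submonoid `A_i^*(I, ζ)` of `H(I, ζ)` generated by the super-letters with basis `i`. -/
def superLetterMonoid (G : SimpleGraph I) (i : I) : Submonoid (Heap G) :=
  Submonoid.closure (superLetters G i)

/-- The heap spelled by a word in the super-letters with basis `i`. -/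
def spelledHeap {G : SimpleGraph I} {i : I} (w : List (superLetters G i)) : Heap G :=
  (w.map Subtype.val).prod

/-- Lyndon words over a totally ordered alphabet: non-empty words that are lexicographically strictly
smaller than all their proper cyclic rotations. -/
def IsLyndonWord {A : Type*} [LinearOrder A] (w : List A) : Prop :=
  w ≠ [] ∧ ∀ k, 0 < k → k < w.length → w < w.rotate k

/-- Super Lyndon words over the alphabet of super-letters with basis `i`. -/
def IsSuperLyndonWord {G : SimpleGraph I} {i : I} (Ψ : Set I) (w : List (superLetters G i)) : Prop :=
  IsLyndonWord w ∨
    ∃ u : List (superLetters G i), (spelledHeap u).IsOdd Ψ ∧ IsLyndonWord u ∧ w = u ++ u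

end HeapsOfPieces

end


/-!
The standard word of a super-letter with basis `i` has the form `i t` with all letters of `t`
greater than `i`. If every position of `E` is at least every position on the floor of `F`, then
`st(E ∘ F) = st(E) st(F)`, so the standard word of a product of super-letters is the concatenation
of the standard words of the factors. As the letter `i` marks where each factor begins, this
concatenation is strictly increasing for the lexicographic orders: words in super-letters embed into
heaps as an ordered monoid, which gives freeness.

The heaps so obtained are those with all positions `≥ i` and only `i` on the floor, a class stable
under left division; this transfers primitivity. If `F` is conjugate to such an `E`, then either `F`
has a position greater than `i` on its floor, and `E < F`, or `F` is in the class too, and so is a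
heap `X` with `E ∘ X = X ∘ F`; in the free monoid this makes the word of `F` a rotation of the word
of `E`.
-/

namespace HeapsOfPieces

namespace Heap

section Content

variable {I : Type*} {G : SimpleGraph I}

/-- The multiset of positions of the pieces of a heap. -/
def content (E : Heap G) : Multiset I := E.pieces.val.map Prod.fst

/-- The set of positions of the pieces at level `0`; these are the minimal pieces (`mem_minPieces`),
and by `mem_floor_iff` the possible first letters of a word representing the heap. -/
def floor (E : Heap G) : Set I := {a | (a, 0) ∈ E.pieces}

lemma mem_content {E : Heap G} {a : I} : a ∈ E.content ↔ ∃ p ∈ E.pieces, p.1 = a := by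
  simp [content]

lemma mem_content_of_mem_floor {E : Heap G} {a : I} (h : a ∈ E.floor) : a ∈ E.content :=
  mem_content.2 ⟨_, h, rfl⟩

lemma content_one : (1 : Heap G).content = 0 := rfl

lemma floor_one : (1 : Heap G).floor = ∅ :=
  Set.eq_empty_of_forall_notMem fun _ => Finset.notMem_empty _

lemma content_single (a : I) : (single G a).content = {a} := rfl

end Content

variable {I : Type*} [LinearOrder I] {G : SimpleGraph I}

lemma count_content (E : Heap G) (a : I) :
    E.content.count a = (E.pieces.filter fun p => p.1 = a).card := by
  rw [content, Multiset.count_map, Finset.card_def, Finset.filter_val]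
  simp only [eq_comm]

lemma content_eq_zero_iff {E : Heap G} : E.content = 0 ↔ E = 1 := by
  rw [content, Multiset.map_eq_zero, Finset.val_eq_zero, Heap.ext_iff, one_pieces]

lemma content_ofWord (w : List I) : (ofWord G w).content = (w : Multiset I) := by
  rw [content, ← one_mul (ofWord G w), ← drop_eq_mul, drop_positions, one_pieces]
  simp

lemma ofWord_cons (a : I) (v : List I) : ofWord G (a :: v) = single G a * ofWord G v := by
  simp [ofWord]

lemma ofWord_append (u v : List I) : ofWord G (u ++ v) = ofWord G u * ofWord G v := by
  simp [ofWord]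

lemma content_mul (E F : Heap G) : (E * F).content = E.content + F.content := by
  obtain ⟨u, rfl⟩ := ofWord_surjective E
  obtain ⟨v, rfl⟩ := ofWord_surjective F
  rw [← ofWord_append, content_ofWord, content_ofWord, content_ofWord, Multiset.coe_add]

lemma mem_content_mul {E F : Heap G} {a : I} :
    a ∈ (E * F).content ↔ a ∈ E.content ∨ a ∈ F.content := by
  rw [content_mul, Multiset.mem_add]

lemma card_content_push (E : Heap G) (a : I) : (E.push a).content.card = E.content.card + 1 := by
  rw [push_eq_mul, content_mul, content_single, Multiset.card_add, Multiset.card_singleton]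

lemma exists_eq_push {E : Heap G} (h : E ≠ 1) : ∃ (F : Heap G) (a : I), E = F.push a :=
  exists_push <| Finset.nonempty_of_ne_empty fun h0 => h (Heap.ext h0)

@[elab_as_elim]
lemma push_induction {P : Heap G → Prop} (one : P 1) (push : ∀ E a, P E → P (E.push a))
    (E : Heap G) : P E := by
  obtain ⟨w, rfl⟩ := ofWord_surjective E
  induction w using List.reverseRecOn with
  | nil => exact one
  | append_singleton w a ih =>
    have hpush : ofWord G (w ++ [a]) = (ofWord G w).push a := by
      rw [ofWord_append, push_eq_mul, ofWord_cons]
      exact congrArg _ (mul_one _)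
    exact hpush ▸ push _ _ ih

lemma restLevel_eq_zero_iff {E : Heap G} {a : I} :
    E.restLevel a = 0 ↔ ∀ b ∈ E.content, ¬ Conc G b a := by
  refine ⟨fun h b hb hc => ?_, fun h => ?_⟩
  · obtain ⟨p, hp, rfl⟩ := mem_content.1 hb
    exact (lt_restLevel hp hc).not_ge (h ▸ Nat.zero_le _)
  · exact restLevel_eq (fun q hq hc => absurd hc (h _ (mem_content.2 ⟨q, hq, rfl⟩))) (by simp)

lemma restLevel_mul_eq_zero_iff {E F : Heap G} {a : I} :
    (E * F).restLevel a = 0 ↔ E.restLevel a = 0 ∧ F.restLevel a = 0 := by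
  simp only [restLevel_eq_zero_iff, mem_content_mul, or_imp, forall_and]

lemma single_commute {E : Heap G} {a : I} (h : E.restLevel a = 0) : Commute (single G a) E := by
  obtain ⟨w, rfl⟩ := ofWord_surjective E
  rw [restLevel_eq_zero_iff, content_ofWord] at h
  have := drop_push (1 : Heap G) a w h
  rwa [drop_eq_mul, push_eq_mul, one_mul, push_eq_mul, drop_eq_mul, one_mul] at this

lemma mem_floor_push {E : Heap G} {a b : I} :
    a ∈ (E.push b).floor ↔ a ∈ E.floor ∨ a = b ∧ E.restLevel b = 0 := by
  simp only [floor, push, Set.mem_ofPred_eq, Finset.mem_insert, Prod.mk.injEq, or_comm, eq_comm]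

lemma mem_floor_mul {E F : Heap G} {a : I} :
    a ∈ (E * F).floor ↔ a ∈ E.floor ∨ a ∈ F.floor ∧ E.restLevel a = 0 := by
  induction F using push_induction with
  | one => simp only [mul_one, floor_one, Set.mem_empty_iff_false, false_and, or_false]
  | push F b ih =>
    rw [mul_push, mem_floor_push, ih, mem_floor_push, restLevel_mul_eq_zero_iff]
    grind

lemma mem_floor_single_mul (a : I) (E : Heap G) : a ∈ (single G a * E).floor :=
  mem_floor_mul.2 (Or.inl (Finset.mem_singleton_self _))

lemma mem_floor_iff {E : Heap G} {a : I} : a ∈ E.floor ↔ ∃ F : Heap G, E = single G a * F := by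
  refine ⟨fun h => ?_, fun ⟨F, hF⟩ => hF ▸ mem_floor_single_mul a F⟩
  induction E using push_induction with
  | one => simp only [floor_one, Set.mem_empty_iff_false] at h
  | push E b ih =>
    rcases mem_floor_push.1 h with h | ⟨rfl, h⟩
    · obtain ⟨F, rfl⟩ := ih h
      exact ⟨F.push b, (mul_push _ _ _).symm⟩
    · exact ⟨E, by rw [push_eq_mul, (single_commute h).eq]⟩

lemma floor_nonempty {E : Heap G} (h : E ≠ 1) : E.floor.Nonempty := by
  obtain ⟨w, rfl⟩ := ofWord_surjective E
  cases w with
  | nil => exact absurd rfl h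
  | cons a w => exact ⟨a, ofWord_cons (G := G) a w ▸ mem_floor_single_mul a _⟩

/-- A piece with no concurrent piece above it, so that removing it leaves a heap. -/
def IsTop (E : Heap G) (p : I × ℕ) : Prop :=
  p ∈ E.pieces ∧ ∀ q ∈ E.pieces, Conc G q.1 p.1 → q.2 ≤ p.2

lemma IsTop.eq_of_conc {E : Heap G} {p q : I × ℕ} (hp : E.IsTop p) (hq : E.IsTop q)
    (h : Conc G p.1 q.1) : p = q :=
  by_contra fun hne => E.level_ne p hp.1 q hq.1 hne h
    ((hq.2 p hp.1 h).antisymm (hp.2 q hq.1 h.symm))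

/-- The heap obtained from `E` by removing the top piece `p`. -/
def removeTop (E : Heap G) {p : I × ℕ} (hp : E.IsTop p) : Heap G where
  pieces := E.pieces.erase p
  level_ne q hq r hr := E.level_ne q (Finset.mem_of_mem_erase hq) r (Finset.mem_of_mem_erase hr)
  supported q hq h0 := by
    have hqE := Finset.mem_of_mem_erase hq
    obtain ⟨r, hr, hlevel, hconc⟩ := E.supported q hqE h0
    refine ⟨r, Finset.mem_erase.2 ⟨?_, hr⟩, hlevel, hconc⟩
    rintro rfl
    have := hp.2 q hqE hconc
    omega

lemma removeTop_push {E : Heap G} {p : I × ℕ} (hp : E.IsTop p) :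
    (E.removeTop hp).push p.1 = E := by
  have hrest : (E.removeTop hp).restLevel p.1 = p.2 := by
    refine restLevel_eq (fun q hq hc => ?_) fun h0 => ?_
    · obtain ⟨hne, hqE⟩ := Finset.mem_erase.1 hq
      exact (hp.2 q hqE hc).lt_of_ne (E.level_ne q hqE p hp.1 hne hc)
    · obtain ⟨q, hq, hlevel, hconc⟩ := E.supported p hp.1 h0
      refine ⟨q, Finset.mem_erase.2 ⟨?_, hq⟩, hlevel, hconc.symm⟩
      rintro rfl
      omega
  ext1
  change insert (p.1, (E.removeTop hp).restLevel p.1) (E.pieces.erase p) = E.pieces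
  rw [hrest, Prod.mk.eta, Finset.insert_erase hp.1]

lemma isTop_push (E : Heap G) (a : I) : (E.push a).IsTop (a, E.restLevel a) := by
  refine ⟨Finset.mem_insert_self _ _, fun q hq hc => ?_⟩
  rcases Finset.mem_insert.1 hq with rfl | hq
  · exact le_rfl
  · exact (lt_restLevel hq hc).le

lemma erase_pieces_push (E : Heap G) (a : I) :
    (E.push a).pieces.erase (a, E.restLevel a) = E.pieces :=
  Finset.erase_insert (not_mem_push E a)

lemma IsTop.of_push {E : Heap G} {a : I} {q : I × ℕ} (hq : (E.push a).IsTop q)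
    (hne : q ≠ (a, E.restLevel a)) : E.IsTop q :=
  ⟨Finset.mem_of_mem_insert_of_ne hq.1 hne, fun r hr => hq.2 r (Finset.mem_insert_of_mem hr)⟩

lemma push_left_injective (a : I) : Function.Injective fun E : Heap G => E.push a := by
  intro X Y (h : X.push a = Y.push a)
  have htop : (a, X.restLevel a) = (a, Y.restLevel a) :=
    (isTop_push X a).eq_of_conc (h ▸ isTop_push Y a) (Or.inl rfl)
  ext1
  rw [← erase_pieces_push X a, ← erase_pieces_push Y a, h, htop]

lemma exists_push_of_push_eq_push {X Y : Heap G} {b c : I} (h : X.push b = Y.push c)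
    (hbc : b ≠ c) : ¬ Conc G b c ∧ ∃ W : Heap G, X = W.push c ∧ Y = W.push b := by
  have hne : (b, X.restLevel b) ≠ (c, Y.restLevel c) := fun he => hbc (Prod.ext_iff.1 he).1
  have hb : (Y.push c).IsTop (b, X.restLevel b) := h ▸ isTop_push X b
  have hc : (X.push b).IsTop (c, Y.restLevel c) := h ▸ isTop_push Y c
  refine ⟨fun hconc => hne ((isTop_push X b).eq_of_conc hc hconc),
    X.removeTop (hc.of_push hne.symm), (removeTop_push _).symm, ?_⟩
  have hW : X.removeTop (hc.of_push hne.symm) = Y.removeTop (hb.of_push hne) := by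
    ext1
    change X.pieces.erase _ = Y.pieces.erase _
    rw [← erase_pieces_push X b, ← erase_pieces_push Y c, ← h, Finset.erase_right_comm]
  rw [hW]
  exact (removeTop_push _).symm

lemma single_mul_left_injective (a : I) : Function.Injective fun E : Heap G => single G a * E := by
  intro X Y (h : single G a * X = single G a * Y)
  have hcontent : X.content = Y.content := by
    simpa only [content_mul, add_right_inj] using congrArg content h
  induction hn : X.content.card generalizing X Y with
  | zero =>
    have hX := Multiset.card_eq_zero.1 hn
    rw [content_eq_zero_iff.1 hX, content_eq_zero_iff.1 (hcontent.symm.trans hX)]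
  | succ n ih =>
    have hX : X.content ≠ 0 := Multiset.card_pos.1 (by omega)
    obtain ⟨X, b, rfl⟩ := exists_eq_push (content_eq_zero_iff.not.1 hX)
    obtain ⟨Y, c, rfl⟩ := exists_eq_push (content_eq_zero_iff.not.1 (hcontent.symm.trans_ne hX))
    rw [mul_push, mul_push] at h
    rw [card_content_push] at hn
    have cancel {Z T : Heap G} (hZ : Z.content.card = n) (hZT : single G a * Z = single G a * T) :
        Z = T :=
      ih hZT (by simpa only [content_mul, add_right_inj] using congrArg content hZT) hZ
    obtain rfl | hbc := eq_or_ne b c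
    · rw [cancel (by omega) (push_left_injective b h)]
    obtain ⟨hconc, W, hX, hY⟩ := exists_push_of_push_eq_push h hbc
    have ha : a ∈ W.floor := by
      have hac := mem_floor_push.1 (hX ▸ mem_floor_single_mul a X)
      have hab := mem_floor_push.1 (hY ▸ mem_floor_single_mul a Y)
      by_contra haW
      exact hbc ((hab.resolve_left haW).1.symm.trans (hac.resolve_left haW).1)
    obtain ⟨W, rfl⟩ := mem_floor_iff.1 ha
    rw [← mul_push] at hX hY
    obtain rfl : X = W.push c := cancel (by omega) hX
    obtain rfl : W.push b = Y :=
      cancel (by rw [card_content_push] at hn ⊢; omega) hY.symm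
    exact (push_comm W hconc).symm

instance : IsLeftCancelMul (Heap G) where
  mul_left_cancel E X Y (h : E * X = E * Y) := by
    obtain ⟨w, rfl⟩ := ofWord_surjective E
    induction w with
    | nil => simpa only [ofWord, List.map_nil, List.prod_nil, one_mul] using h
    | cons a w ih =>
      rw [ofWord_cons, mul_assoc, mul_assoc] at h
      exact ih (single_mul_left_injective a h)

lemma ofWord_standardWord (E : Heap G) : ofWord G E.standardWord = E := (standardWord_spec E).1

lemma le_standardWord_ofWord (w : List I) : w ≤ (ofWord G w).standardWord :=
  (standardWord_spec (ofWord G w)).2 rfl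

lemma coe_standardWord (E : Heap G) : (E.standardWord : Multiset I) = E.content := by
  rw [← content_ofWord (G := G), ofWord_standardWord]

lemma mem_standardWord {E : Heap G} {a : I} : a ∈ E.standardWord ↔ a ∈ E.content := by
  rw [← coe_standardWord, Multiset.mem_coe]

lemma standardWord_eq_nil_iff {E : Heap G} : E.standardWord = [] ↔ E = 1 := by
  rw [← content_eq_zero_iff, ← coe_standardWord, Multiset.coe_eq_zero]

lemma exists_cons_le_standardWord {E : Heap G} {a : I} (h : a ∈ E.floor) :
    ∃ t, a :: t ≤ E.standardWord := by
  obtain ⟨F, rfl⟩ := mem_floor_iff.1 h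
  refine ⟨F.standardWord, ?_⟩
  simpa only [ofWord_cons, ofWord_standardWord] using
    le_standardWord_ofWord (G := G) (a :: F.standardWord)

lemma eq_single_mul_of_standardWord_eq_cons {E : Heap G} {a : I} {t : List I}
    (h : E.standardWord = a :: t) : E = single G a * ofWord G t := by
  rw [← ofWord_cons, ← h, ofWord_standardWord]

lemma isGreatest_floor_of_standardWord_eq_cons {E : Heap G} {a : I} {t : List I}
    (h : E.standardWord = a :: t) : IsGreatest E.floor a := by
  refine ⟨mem_floor_iff.2 ⟨_, eq_single_mul_of_standardWord_eq_cons h⟩, fun b hb => ?_⟩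
  obtain ⟨s, hs⟩ := exists_cons_le_standardWord hb
  by_contra! hlt
  exact (h ▸ hs).not_gt (List.cons_lt_cons_iff.2 (Or.inl hlt))

lemma standardWord_single_mul {a : I} {E : Heap G} (h : ∀ b ∈ (single G a * E).floor, b ≤ a) :
    (single G a * E).standardWord = a :: E.standardWord := by
  refine (standardWord_spec _).unique ⟨?_, fun v (hv : ofWord G v = _) => not_lt.1 fun hlt => ?_⟩
  · change ofWord G (a :: E.standardWord) = _
    rw [ofWord_cons, ofWord_standardWord]
  · cases v with
    | nil => exact List.not_lt_nil _ hlt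
    | cons b v =>
      rw [ofWord_cons] at hv
      have hba : b ≤ a := h b (hv ▸ mem_floor_single_mul b _)
      obtain hab | ⟨rfl, htail⟩ := List.cons_lt_cons_iff.1 hlt
      · exact hba.not_gt hab
      · exact htail.not_ge (mul_left_cancel hv ▸ le_standardWord_ofWord v)

lemma standardWord_mul {E F : Heap G} (h : ∀ a ∈ E.content, ∀ b ∈ F.floor, b ≤ a) :
    (E * F).standardWord = E.standardWord ++ F.standardWord := by
  induction hs : E.standardWord generalizing E with
  | nil => rw [standardWord_eq_nil_iff.1 hs, one_mul, List.nil_append]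
  | cons a t ih =>
    have hmax := (isGreatest_floor_of_standardWord_eq_cons hs).2
    obtain ⟨E', rfl⟩ : ∃ E', E = single G a * E' := ⟨_, eq_single_mul_of_standardWord_eq_cons hs⟩
    have ht : E'.standardWord = t :=
      (List.cons_eq_cons.1 ((standardWord_single_mul hmax).symm.trans hs)).2
    have ha : a ∈ (single G a * E').content := mem_content_of_mem_floor (mem_floor_single_mul a E')
    have hmax' : ∀ b ∈ (single G a * (E' * F)).floor, b ≤ a := fun b hb => by
      rw [← mul_assoc] at hb
      exact (mem_floor_mul.1 hb).elim (hmax ·) fun hb => h a ha b hb.1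
    rw [mul_assoc, standardWord_single_mul hmax',
      ih (fun b hb => h b (mem_content_mul.2 (Or.inr hb))) ht, List.cons_append]

lemma lt_iff_standardWord_lt {E F : Heap G} : E < F ↔ E.standardWord < F.standardWord := Iff.rfl

lemma lt_of_floor_lt {E F : Heap G} {a : I} (ha : a ∈ F.floor) (h : ∀ b ∈ E.floor, b < a) :
    E < F := by
  obtain ⟨t, ht⟩ := exists_cons_le_standardWord ha
  refine lt_iff_standardWord_lt.2 (lt_of_lt_of_le ?_ ht)
  cases hs : E.standardWord with
  | nil => exact List.nil_lt_cons _ _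
  | cons b s =>
    exact List.cons_lt_cons_iff.2 (Or.inl (h b (isGreatest_floor_of_standardWord_eq_cons hs).1))

lemma mem_minPieces {E : Heap G} {p : I × ℕ} : p ∈ E.minPieces ↔ p ∈ E.pieces ∧ p.2 = 0 := by
  constructor
  · rintro ⟨hp, hmin⟩
    refine ⟨hp, by_contra fun h0 => ?_⟩
    obtain ⟨q, hq, hlevel, hconc⟩ := E.supported p hp (Nat.pos_of_ne_zero h0)
    obtain rfl := hmin q hq (.single ⟨hq, hp, hconc.symm, by omega⟩)
    omega
  · rintro ⟨hp, h0⟩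
    refine ⟨hp, fun q _ hqp => ?_⟩
    rcases Relation.ReflTransGen.cases_tail hqp with h | ⟨r, -, -, -, -, hlt⟩
    · exact h.symm
    · omega

lemma isPyramid_iff {E : Heap G} {i : I} : E.IsPyramid i ↔ E.floor = {i} := by
  have mem_floor {a : I} : a ∈ E.floor ↔ (a, 0) ∈ E.minPieces := by
    simp only [floor, Set.mem_ofPred_eq, mem_minPieces, and_true]
  constructor
  · rintro ⟨n, hn⟩
    obtain rfl : n = 0 := (mem_minPieces.1 (hn ▸ rfl : (i, n) ∈ E.minPieces)).2
    ext a
    simp only [mem_floor, hn, Set.mem_singleton_iff, Prod.mk.injEq, and_true]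
  · refine fun h => ⟨0, Set.ext fun ⟨a, n⟩ => ?_⟩
    rw [Set.mem_singleton_iff, Prod.mk.injEq, ← Set.mem_singleton_iff, ← h, mem_floor,
      mem_minPieces, mem_minPieces]
    grind

/-- The heap is empty or an admissible pyramid with basis `i`; by `exists_spelledHeap_eq_iff` these
are the products of super-letters with basis `i`. -/
def IsBasedAt (E : Heap G) (i : I) : Prop := E.floor ⊆ {i} ∧ ∀ a ∈ E.content, i ≤ a

lemma isBasedAt_one (i : I) : (1 : Heap G).IsBasedAt i :=
  ⟨floor_one.trans_subset (Set.empty_subset _), by simp [content_one]⟩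

lemma IsBasedAt.mul {E F : Heap G} {i : I} (hE : E.IsBasedAt i) (hF : F.IsBasedAt i) :
    (E * F).IsBasedAt i :=
  ⟨fun _ ha => (mem_floor_mul.1 ha).elim (hE.1 ·) fun h => hF.1 h.1,
    fun a ha => (mem_content_mul.1 ha).elim (hE.2 a) (hF.2 a)⟩

lemma IsBasedAt.of_mul {E F : Heap G} {i : I} (h : (E * F).IsBasedAt i) : E.IsBasedAt i :=
  ⟨fun _ ha => h.1 (mem_floor_mul.2 (Or.inl ha)), fun a ha => h.2 a (mem_content_mul.2 (Or.inl ha))⟩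

lemma IsBasedAt.floor_eq {E : Heap G} {i : I} (h : E.IsBasedAt i) (h1 : E ≠ 1) : E.floor = {i} :=
  (floor_nonempty h1).subset_singleton_iff.1 h.1

lemma IsBasedAt.of_mul_eq_mul {E F X : Heap G} {i : I} (hE : E.IsBasedAt i) (h : E * X = X * F)
    (hX : X.content ⊆ E.content) : X.IsBasedAt i := by
  refine ⟨fun a ha => ?_, fun a ha => hE.2 a (hX ha)⟩
  rcases mem_floor_mul.1 (h ▸ mem_floor_mul.2 (Or.inl ha) : a ∈ (E * X).floor) with haE | ⟨-, h0⟩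
  · exact hE.1 haE
  · exact absurd (Or.inl rfl)
      (restLevel_eq_zero_iff.1 h0 a (hX (mem_content_of_mem_floor ha)))

lemma IsTranspose.content_eq {E F : Heap G} (h : IsTranspose E F) : E.content = F.content := by
  obtain ⟨U, V, rfl, rfl⟩ := h
  rw [content_mul, content_mul, add_comm]

lemma IsTranspose.exists_mul_eq_mul {E F : Heap G} (h : IsTranspose E F) :
    ∃ X : Heap G, E * X = X * F ∧ X.content ⊆ E.content := by
  obtain ⟨U, V, rfl, rfl⟩ := h
  exact ⟨U, mul_assoc _ _ _, fun a ha => mem_content_mul.2 (Or.inl ha)⟩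

lemma IsConjugate.content_eq {E F : Heap G} (h : IsConjugate E F) : E.content = F.content := by
  induction h with
  | single h => exact h.content_eq
  | tail _ h ih => exact ih.trans h.content_eq

lemma IsConjugate.exists_mul_eq_mul {E F : Heap G} (h : IsConjugate E F) :
    ∃ X : Heap G, E * X = X * F ∧ X.content ⊆ E.content := by
  induction h with
  | single h => exact h.exists_mul_eq_mul
  | tail hconj h ih =>
    obtain ⟨X, hX, hXE⟩ := ih
    obtain ⟨Y, hY, hYE⟩ := h.exists_mul_eq_mul
    rw [← IsConjugate.content_eq hconj] at hYE
    refine ⟨X * Y, by rw [← mul_assoc, hX, mul_assoc, hY, mul_assoc], fun a ha => ?_⟩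
    exact (mem_content_mul.1 ha).elim (hXE ·) (hYE ·)

end Heap

section Words

variable {A : Type*} {u v w : List A}

lemma exists_eq_append_of_append_eq_append {x : List A} (h : v ++ x = x ++ w) :
    ∃ s t, v = s ++ t ∧ w = t ++ s := by
  induction hn : x.length using Nat.strong_induction_on generalizing x with
  | _ n ih =>
    rcases List.append_eq_append_iff.1 h with ⟨y, rfl, hy⟩ | ⟨y, rfl, rfl⟩
    · obtain rfl | hv := eq_or_ne v []
      · exact ⟨[], [], rfl, by simpa using h⟩
      · have := List.length_pos_iff.2 hv
        rw [List.length_append] at hn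
        exact ih y.length (by omega) hy rfl
    · exact ⟨x, y, rfl, rfl⟩

variable [LinearOrder A]

lemma isLyndonWord_iff_forall_append :
    IsLyndonWord w ↔ w ≠ [] ∧ ∀ u v, u ≠ [] → v ≠ [] → w = u ++ v → w < v ++ u := by
  refine and_congr_right fun _ => ⟨?_, fun h k hk hkw => ?_⟩
  · rintro h u v hu hv rfl
    have hv' := List.length_pos_iff.2 hv
    simpa only [List.rotate_append_length_eq] using
      h u.length (List.length_pos_iff.2 hu) (by rw [List.length_append]; omega)
  · rw [List.rotate_eq_drop_append_take hkw.le]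
    refine h _ _ (List.ne_nil_of_length_pos ?_) (List.ne_nil_of_length_pos ?_)
      (List.take_append_drop k w).symm
    · rw [List.length_take]; omega
    · rw [List.length_drop]; omega

lemma IsLyndonWord.append_le (h : IsLyndonWord (u ++ v)) : u ++ v ≤ v ++ u := by
  obtain rfl | hu := eq_or_ne u []
  · rw [List.nil_append, List.append_nil]
  obtain rfl | hv := eq_or_ne v []
  · rw [List.nil_append, List.append_nil]
  exact ((isLyndonWord_iff_forall_append.1 h).2 u v hu hv rfl).le

lemma IsLyndonWord.eq_nil_or_eq_nil (h : IsLyndonWord (u ++ v)) (hcomm : u ++ v = v ++ u) :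
    u = [] ∨ v = [] := by
  by_contra! hne
  exact ((isLyndonWord_iff_forall_append.1 h).2 u v hne.1 hne.2 rfl).ne hcomm

lemma append_lt_append_of_forall_head_lt {r r' : List A} (huv : u < v)
    (h : ∀ a ∈ r.head?, ∀ b ∈ v, a < b) : u ++ r < v ++ r' := by
  induction u generalizing v with
  | nil =>
    cases v with
    | nil => exact absurd huv (lt_irrefl _)
    | cons b v =>
      cases r with
      | nil => exact List.nil_lt_cons _ _
      | cons a r => exact List.cons_lt_cons_iff.2 (Or.inl (h a rfl b List.mem_cons_self))
  | cons a u ih =>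
    cases v with
    | nil => exact absurd huv (List.not_lt_nil _)
    | cons b v =>
      rw [List.cons_append, List.cons_append, List.cons_lt_cons_iff]
      refine (List.cons_lt_cons_iff.1 huv).imp_right fun ⟨hab, htail⟩ => ⟨hab, ih htail ?_⟩
      exact fun c hc d hd => h c hc d (List.mem_cons_of_mem _ hd)

/-- Words `i t` with all letters of `t` greater than `i`; in a concatenation of such words each
occurrence of `i` marks the beginning of a factor. -/
def IsBlock (i : A) (w : List A) : Prop := ∃ t, w = i :: t ∧ ∀ a ∈ t, i < a

lemma strictMono_flatMap_of_isBlock {B : Type*} [LinearOrder B] {i : A} {f : B → List A}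
    (hf : StrictMono f) (hblock : ∀ x, IsBlock i (f x)) :
    StrictMono fun w : List B => w.flatMap f := by
  have head_eq (w : List B) : ∀ a ∈ (w.flatMap f).head?, a = i := by
    cases w with
    | nil => simp
    | cons x w => obtain ⟨t, ht, -⟩ := hblock x; simp [ht]
  intro u
  induction u with
  | nil =>
    intro v huv
    cases v with
    | nil => exact absurd huv (lt_irrefl _)
    | cons y v => obtain ⟨t, ht, -⟩ := hblock y; simp [ht]
  | cons x u ih =>
    intro v huv
    cases v with
    | nil => exact absurd huv (List.not_lt_nil _)
    | cons y v =>
      simp only [List.flatMap_cons]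
      rcases List.cons_lt_cons_iff.1 huv with hxy | ⟨rfl, htail⟩
      · obtain ⟨s, hs, -⟩ := hblock x
        obtain ⟨t, ht, hit⟩ := hblock y
        have hst : s < t := by simpa [hs, ht] using hf hxy
        rw [hs, ht, List.cons_append, List.cons_append, List.cons_lt_cons_self]
        exact append_lt_append_of_forall_head_lt hst fun a ha b hb => head_eq u a ha ▸ hit b hb
      · exact List.append_left_lt (ih htail)

end Words

open Heap

variable {I : Type*} [LinearOrder I] {G : SimpleGraph I} {i : I}

lemma mem_superLetters_iff {E : Heap G} :
    E ∈ superLetters G i ↔ E.IsBasedAt i ∧ E.content.count i = 1 := by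
  have hcontent : (∀ p ∈ E.pieces, i ≤ p.1) ↔ ∀ a ∈ E.content, i ≤ a := by
    simp only [mem_content, forall_exists_index, and_imp, forall_apply_eq_imp_iff₂]
  simp only [superLetters, IsAdmissiblePyramid, IsElementaryPyramid, Set.mem_ofPred_eq,
    isPyramid_iff, ← count_content, hcontent]
  refine ⟨fun h => ⟨⟨h.1.1.subset, h.1.2⟩, h.2.2⟩, fun h => ?_⟩
  have h1 : E ≠ 1 := by
    rintro rfl
    simp [content_one] at h
  exact ⟨⟨h.1.floor_eq h1, h.1.2⟩, h.1.floor_eq h1, h.2⟩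

lemma isBlock_standardWord {E : Heap G} (h : E ∈ superLetters G i) :
    IsBlock i E.standardWord := by
  obtain ⟨hbased, hcount⟩ := mem_superLetters_iff.1 h
  rw [← coe_standardWord, Multiset.coe_count] at hcount
  cases hs : E.standardWord with
  | nil => simp [hs] at hcount
  | cons a t =>
    obtain rfl : a = i := hbased.1 (isGreatest_floor_of_standardWord_eq_cons hs).1
    have hat : a ∉ t := by simpa [hs, List.count_eq_zero] using hcount
    refine ⟨t, rfl, fun b hb => (hbased.2 b ?_).lt_of_ne (ne_of_mem_of_not_mem hb hat).symm⟩
    exact mem_standardWord.1 (hs ▸ List.mem_cons_of_mem _ hb)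

lemma spelledHeap_cons (x : superLetters G i) (w : List (superLetters G i)) :
    spelledHeap (x :: w) = x.1 * spelledHeap w := by
  simp [spelledHeap]

lemma spelledHeap_append (u v : List (superLetters G i)) :
    spelledHeap (u ++ v) = spelledHeap u * spelledHeap v := by
  simp [spelledHeap]

lemma isBasedAt_spelledHeap (w : List (superLetters G i)) : (spelledHeap w).IsBasedAt i := by
  induction w with
  | nil => exact isBasedAt_one i
  | cons x w ih => exact spelledHeap_cons x w ▸ (mem_superLetters_iff.1 x.2).1.mul ih

lemma standardWord_spelledHeap (w : List (superLetters G i)) :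
    (spelledHeap w).standardWord = w.flatMap fun x => x.1.standardWord := by
  induction w with
  | nil => exact standardWord_eq_nil_iff.2 rfl
  | cons x w ih =>
    have hx := (mem_superLetters_iff.1 x.2).1
    rw [spelledHeap_cons, List.flatMap_cons, ← ih]
    exact standardWord_mul fun a ha b hb => (isBasedAt_spelledHeap w).1 hb ▸ hx.2 a ha

lemma spelledHeap_strictMono : StrictMono (spelledHeap (G := G) (i := i)) := by
  have hflatMap : StrictMono fun w : List (superLetters G i) =>
      w.flatMap fun x => x.1.standardWord :=
    strictMono_flatMap_of_isBlock (fun _ _ h => h) fun x => isBlock_standardWord x.2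
  intro u v huv
  rw [lt_iff_standardWord_lt, standardWord_spelledHeap, standardWord_spelledHeap]
  exact hflatMap huv

lemma spelledHeap_injective : Function.Injective (spelledHeap (G := G) (i := i)) :=
  spelledHeap_strictMono.injective

lemma spelledHeap_eq_one_iff {w : List (superLetters G i)} : spelledHeap w = 1 ↔ w = [] :=
  spelledHeap_injective.eq_iff' rfl

lemma exists_eq_mul_spelledHeap {E : Heap G} (h : ∀ a ∈ E.content, i ≤ a) :
    ∃ (P : Heap G) (w : List (superLetters G i)),
      E = P * spelledHeap w ∧ ∀ a ∈ P.content, i < a := by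
  induction hn : E.content.card generalizing E with
  | zero =>
    obtain rfl := content_eq_zero_iff.1 (Multiset.card_eq_zero.1 hn)
    exact ⟨1, [], (one_mul _).symm, by simp [content_one]⟩
  | succ n ih =>
    have h1 : E ≠ 1 := content_eq_zero_iff.not.1 (Multiset.card_pos.1 (by omega))
    by_cases hfloor : E.floor ⊆ {i}
    · obtain ⟨F, rfl⟩ := mem_floor_iff.1 (IsBasedAt.floor_eq ⟨hfloor, h⟩ h1 ▸ rfl : i ∈ E.floor)
      rw [content_mul, content_single, Multiset.singleton_add, Multiset.card_cons] at hn
      obtain ⟨P, w, rfl, hP⟩ := ih (fun a ha => h a (mem_content_mul.2 (Or.inr ha))) (by omega)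
      rw [← mul_assoc] at h hfloor ⊢
      have hletter : single G i * P ∈ superLetters G i := by
        refine mem_superLetters_iff.2 ⟨IsBasedAt.of_mul ⟨hfloor, h⟩, ?_⟩
        rw [content_mul, content_single, Multiset.singleton_add, Multiset.count_cons_self,
          Multiset.count_eq_zero_of_notMem fun hi => (hP i hi).false]
      exact ⟨1, ⟨_, hletter⟩ :: w, by rw [one_mul, spelledHeap_cons], by simp [content_one]⟩
    · obtain ⟨a, ha, hai⟩ := Set.not_subset.1 hfloor
      have hia : i < a := (h a (mem_content_of_mem_floor ha)).lt_of_ne' hai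
      obtain ⟨F, rfl⟩ := mem_floor_iff.1 ha
      rw [content_mul, content_single, Multiset.singleton_add, Multiset.card_cons] at hn
      obtain ⟨P, w, rfl, hP⟩ := ih (fun b hb => h b (mem_content_mul.2 (Or.inr hb))) (by omega)
      refine ⟨single G a * P, w, (mul_assoc _ _ _).symm, fun b hb => ?_⟩
      rw [content_mul, content_single, Multiset.singleton_add, Multiset.mem_cons] at hb
      exact hb.elim (fun hba => hba ▸ hia) (hP b)

lemma exists_spelledHeap_eq_iff {E : Heap G} :
    (∃ w : List (superLetters G i), spelledHeap w = E) ↔ E.IsBasedAt i := by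
  refine ⟨fun ⟨w, hw⟩ => hw ▸ isBasedAt_spelledHeap w, fun h => ?_⟩
  obtain ⟨P, w, rfl, hP⟩ := exists_eq_mul_spelledHeap h.2
  obtain rfl : P = 1 := by
    by_contra hP1
    have hi : i ∈ P.floor := h.of_mul.floor_eq hP1 ▸ rfl
    exact (hP i (mem_content_of_mem_floor hi)).false
  exact ⟨w, (one_mul _).symm⟩

lemma mem_range_spelledHeap_of_mem_superLetterMonoid {E : Heap G}
    (h : E ∈ superLetterMonoid G i) : E ∈ Set.range (spelledHeap (G := G) (i := i)) := by
  obtain ⟨l, hl, rfl⟩ := Submonoid.exists_list_of_mem_closure h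
  lift l to List (superLetters G i) using hl
  exact ⟨l, rfl⟩

lemma isLyndonWord_of_isLyndon {w : List (superLetters G i)} (h : (spelledHeap w).IsLyndon) :
    IsLyndonWord w := by
  obtain ⟨h1, hprim, hmin⟩ := h
  refine isLyndonWord_iff_forall_append.2 ⟨spelledHeap_eq_one_iff.not.1 h1, ?_⟩
  rintro u v hu hv rfl
  rw [spelledHeap_append] at hprim hmin
  rw [← spelledHeap_strictMono.lt_iff_lt, spelledHeap_append, spelledHeap_append]
  refine (hmin _ (.single ⟨_, _, rfl, rfl⟩)).lt_of_ne fun hcomm => ?_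
  exact (hprim _ _ rfl hcomm).elim (hu ∘ spelledHeap_eq_one_iff.1) (hv ∘ spelledHeap_eq_one_iff.1)

lemma IsLyndonWord.isPrimitive_spelledHeap {w : List (superLetters G i)} (h : IsLyndonWord w) :
    (spelledHeap w).IsPrimitive := by
  intro U V hUV hVU
  have hbased := isBasedAt_spelledHeap w
  obtain ⟨u, rfl⟩ := exists_spelledHeap_eq_iff.2 (hUV ▸ hbased).of_mul
  obtain ⟨v, rfl⟩ := exists_spelledHeap_eq_iff.2 (hVU ▸ hbased).of_mul
  rw [← spelledHeap_append] at hUV hVU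
  obtain rfl : w = u ++ v := spelledHeap_injective hUV
  rw [spelledHeap_eq_one_iff, spelledHeap_eq_one_iff]
  exact h.eq_nil_or_eq_nil (spelledHeap_injective hVU)

lemma IsLyndonWord.spelledHeap_le_of_isConjugate {w : List (superLetters G i)}
    (h : IsLyndonWord w) {F : Heap G} (hF : IsConjugate (spelledHeap w) F) :
    spelledHeap w ≤ F := by
  have hbased := isBasedAt_spelledHeap w
  have hFi : ∀ a ∈ F.content, i ≤ a := IsConjugate.content_eq hF ▸ hbased.2
  by_cases hfloor : F.floor ⊆ {i}
  · obtain ⟨X, hX, hXw⟩ := IsConjugate.exists_mul_eq_mul hF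
    obtain ⟨x, rfl⟩ := exists_spelledHeap_eq_iff.2 (hbased.of_mul_eq_mul hX hXw)
    obtain ⟨f, rfl⟩ := exists_spelledHeap_eq_iff.2 (⟨hfloor, hFi⟩ : F.IsBasedAt i)
    rw [← spelledHeap_append, ← spelledHeap_append] at hX
    obtain ⟨u, v, rfl, rfl⟩ := exists_eq_append_of_append_eq_append (spelledHeap_injective hX)
    exact spelledHeap_strictMono.monotone h.append_le
  · obtain ⟨a, ha, hai⟩ := Set.not_subset.1 hfloor
    have hia : i < a := (hFi a (mem_content_of_mem_floor ha)).lt_of_ne' hai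
    exact (lt_of_floor_lt ha fun b hb => hbased.1 hb ▸ hia).le

theorem isLyndonWord_iff_isLyndon {w : List (superLetters G i)} :
    IsLyndonWord w ↔ (spelledHeap w).IsLyndon :=
  ⟨fun h => ⟨spelledHeap_eq_one_iff.not.2 h.1, h.isPrimitive_spelledHeap,
    fun _ hF => h.spelledHeap_le_of_isConjugate hF⟩, isLyndonWord_of_isLyndon⟩

theorem isSuperLyndonWord_iff_isSuperLyndon (Ψ : Set I) {w : List (superLetters G i)} :
    IsSuperLyndonWord Ψ w ↔ (spelledHeap w).IsSuperLyndon Ψ := by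
  refine or_congr isLyndonWord_iff_isLyndon ⟨?_, ?_⟩
  · rintro ⟨u, hodd, hu, rfl⟩
    exact ⟨spelledHeap u, hodd, isLyndonWord_iff_isLyndon.1 hu, spelledHeap_append u u⟩
  · rintro ⟨F, hodd, hF, hw⟩
    obtain ⟨u, rfl⟩ := exists_spelledHeap_eq_iff.2 (hw ▸ isBasedAt_spelledHeap w).of_mul
    rw [← spelledHeap_append] at hw
    exact ⟨u, hodd, isLyndonWord_iff_isLyndon.2 hF, spelledHeap_injective hw⟩

end HeapsOfPieces

theorem mainTheorem8 {I : Type*} [LinearOrder I] (G : SimpleGraph I) (Ψ : Set I) (i : I)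
    (E : HeapsOfPieces.Heap G) (hE : E ∈ HeapsOfPieces.superLetterMonoid G i) :
    (∃! w : List (HeapsOfPieces.superLetters G i), HeapsOfPieces.spelledHeap w = E) ∧
    ∀ w : List (HeapsOfPieces.superLetters G i), HeapsOfPieces.spelledHeap w = E →
      (HeapsOfPieces.IsSuperLyndonWord Ψ w ↔ E.IsSuperLyndon Ψ) := by
  refine ⟨HeapsOfPieces.spelledHeap_injective.existsUnique_of_mem_range
    (HeapsOfPieces.mem_range_spelledHeap_of_mem_superLetterMonoid hE), ?_⟩
  rintro w rfl
  exact HeapsOfPieces.isSuperLyndonWord_iff_isSuperLyndon Ψ
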